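/- Let $n \ge 0$, and give $\mathbb{RP}^n$ and $\mathbb{CP}^n$ their usual (quotient) topologies; a projective line is the projectivization of a two-dimensional linear subspace. A set $E \subset \mathbb{RP}^n$ is called convex if it contains no projective line and $E \cap L$ is connected (possibly empty) for every projective line $L$. A set $E \subset \mathbb{CP}^n$ is called $\mathbb{C}$-convex if it contains no (complex) projective line and, for every projective line $L$, the intersection $E \cap L$ is either empty or connected and simply connected. For nonzero $v_0, v_1 \in \mathbb{R}^{n+1}$ consider the closed segment $$I = \{[c_0 v_0 + c_1 v_1] : c_0, c_1 \in \mathbb{R},\ c_0 c_1 \ge 0,\ c_0 v_0 + c_1 v_1 \ne 0\} \subset \mathbb{RP}^n$$ (a single point if $[v_0] = [v_1]$) and the closed disc with diameter $I$, $$I^e = \{[c_0 v_0 + c_1 v_1] : c_0, c_1 \in \mathbb{C},\ \operatorname{Re}(c_0 \overline{c_1}) \ge 0,\ c_0 v_0 + c_1 v_1 \ne 0\} \subset \mathbb{CP}^n.$$ The elliptic tube over a set $D \subset \mathbb{RP}^n$ is $D^e = \bigcup \{ I^e : I \subset D \text{ a closed segment}\} \subset \mathbb{CP}^n$. If $D \subset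 \mathbb{RP}^n$ is a convex open set (not necessarily properly convex), then $D^e$ is $\mathbb{C}$-convex. -/

import Mathlib

open scoped LinearAlgebra.Projectivization ComplexConjugate

/-- The topology of a projective space: the quotient topology along the projection
from the nonzero vectors. -/
instance Projectivization.quotientTopology {K V : Type*} [DivisionRing K] [AddCommGroup V]
    [Module K V] [TopologicalSpace V] : TopologicalSpace (ℙ K V) :=
  inferInstanceAs (TopologicalSpace (Quotient (projectivizationSetoid K V)))

/-- Real projective space of dimension `n`. -/
abbrev RealProj (n : ℕ) : Type := ℙ ℝ (Fin (n + 1) → ℝ)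

/-- Complex projective space of dimension `n`. -/
abbrev ComplexProj (n : ℕ) : Type := ℙ ℂ (Fin (n + 1) → ℂ)

/-- A projective line: the set of all points lying in some two-dimensional linear subspace. -/
def IsProjectiveLine {K V : Type*} [DivisionRing K] [AddCommGroup V] [Module K V]
    (L : Set (ℙ K V)) : Prop :=
  ∃ W : Submodule K V, Module.finrank K W = 2 ∧ L = {x | x.submodule ≤ W}

/-- Convexity in real projective space: the set contains no projective line and meets every
projective line in a connected (possibly empty) set. -/
def IsProjConvex {n : ℕ} (E : Set (RealProj n)) : Prop :=
  ∀ L : Set (RealProj n), IsProjectiveLine L → ¬ L ⊆ E ∧ IsPreconnected (E ∩ L)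

/-- `ℂ`-convexity in complex projective space: the set contains no projective line and meets every
projective line in a connected and simply connected (possibly empty) set. -/
def IsComplexConvex {n : ℕ} (E : Set (ComplexProj n)) : Prop :=
  ∀ L : Set (ComplexProj n), IsProjectiveLine L →
    ¬ L ⊆ E ∧ IsPreconnected (E ∩ L) ∧ ((E ∩ L).Nonempty → IsSimplyConnected (E ∩ L))

/-- The inclusion of `ℝ^(n+1)` in `ℂ^(n+1)`. -/
def complexifyVec {n : ℕ} (v : Fin (n + 1) → ℝ) : Fin (n + 1) → ℂ := fun i => (v i : ℂ)

/-- The closed segment with end points `[v₀]` and `[v₁]` that consists of the points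
`[c₀ v₀ + c₁ v₁]` with `c₀ c₁ ≥ 0`. The other segment with these end points is obtained by
changing the sign of `v₁`. -/
def closedSeg {n : ℕ} (v₀ v₁ : Fin (n + 1) → ℝ) : Set (RealProj n) :=
  {x | ∃ c₀ c₁ : ℝ, 0 ≤ c₀ * c₁ ∧
    ∃ h : c₀ • v₀ + c₁ • v₁ ≠ 0, x = Projectivization.mk ℝ (c₀ • v₀ + c₁ • v₁) h}

/-- The closed disc, in the complexification of the real projective line through `[v₀]` and `[v₁]`,
whose diameter is the closed segment `closedSeg v₀ v₁`. -/
def segDisc {n : ℕ} (v₀ v₁ : Fin (n + 1) → ℝ) : Set (ComplexProj n) :=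
  {z | ∃ c₀ c₁ : ℂ, 0 ≤ (c₀ * conj c₁).re ∧
    ∃ h : c₀ • complexifyVec v₀ + c₁ • complexifyVec v₁ ≠ 0,
      z = Projectivization.mk ℂ (c₀ • complexifyVec v₀ + c₁ • complexifyVec v₁) h}

/-- The elliptic tube with base `D`: the union of the discs over all closed segments contained
in `D` (a single point counts as a segment, and the disc over it is this point). -/
def ellipticTube {n : ℕ} (D : Set (RealProj n)) : Set (ComplexProj n) :=
  {z | ∃ v₀ v₁ : Fin (n + 1) → ℝ, v₀ ≠ 0 ∧ v₁ ≠ 0 ∧ closedSeg v₀ v₁ ⊆ D ∧ z ∈ segDisc v₀ v₁}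

open Set Filter Topology

/-! ### Quotient topology of projective space and cones over its subsets -/

section ProjectiveTopology

variable {K V : Type*} [Field K] [AddCommGroup V] [Module K V]

/-! A nonempty open convex `D` lifts to an open convex cone `C` with `coneOver D = C ∪ -C`
(`IsProjConvex.exists_convex_cone`), and `D^e` is then the projectivization of the convex set `C +
iC` (`ellipticTube_eq_projImage`).

A real functional negative on `C` extends to a complex functional `f` without zeros on `C + iC`. So
`D^e` misses the hyperplane `f = 0`, which meets every projective line; hence `D^e` contains no
line.

For a line given by a plane `W`, the section of `D^e` is the image of the convex set `(C + iC) ∩ W`.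
Over each point of the image, the admissible scalars form a convex subset of `ℂ`, so a partition of
unity gives a continuous section. The image is thus a retract of a convex set, hence contractible if
nonempty (`contractibleSpace_projImage`). -/

theorem Projectivization.isOpenQuotientMap_mk' [TopologicalSpace V] [ContinuousConstSMul K V] :
    IsOpenQuotientMap (Projectivization.mk' K : {v : V // v ≠ 0} → ℙ K V) where
  surjective := Quotient.mk_surjective
  continuous := continuous_quotient_mk'
  isOpenMap := by
    intro O hO
    have key : (Projectivization.mk' K : {v : V // v ≠ 0} → ℙ K V) ⁻¹'
        (Projectivization.mk' K '' O) =
          ⋃ c : Kˣ, (fun v : {v : V // v ≠ 0} =>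
            (⟨c • (v : V), (smul_ne_zero_iff_ne c).2 v.2⟩ : {v : V // v ≠ 0})) ⁻¹' O := by
      ext v
      simp only [mem_preimage, mem_image, mem_iUnion, Projectivization.mk'_eq_mk]
      constructor
      · rintro ⟨w, hw, h⟩
        obtain ⟨c, hc⟩ := (Projectivization.mk_eq_mk_iff K _ _ w.2 v.2).1 h
        exact ⟨c, by convert hw⟩
      · rintro ⟨c, hc⟩
        exact ⟨_, hc, (Projectivization.mk_eq_mk_iff K _ _ _ _).2 ⟨c, rfl⟩⟩
    change IsOpen ((Projectivization.mk' K : {v : V // v ≠ 0} → ℙ K V) ⁻¹' _)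
    rw [key]
    refine isOpen_iUnion fun c => hO.preimage ?_
    exact Continuous.subtype_mk (continuous_subtype_val.const_smul (c : K)) _

/-- The image in projective space of the nonzero vectors of a set. -/
def projImage (K : Type*) {V : Type*} [Field K] [AddCommGroup V] [Module K V] (U : Set V) :
    Set (ℙ K V) :=
  {x | ∃ w ∈ U, ∃ h : w ≠ 0, x = Projectivization.mk K w h}

theorem isOpen_projImage [TopologicalSpace V] [ContinuousConstSMul K V] {U : Set V} (hU : IsOpen U) :
    IsOpen (projImage K U) := by
  convert (Projectivization.isOpenQuotientMap_mk' (K := K)).isOpenMap _ (hU.preimage continuous_subtype_val)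
  ext x
  constructor
  · rintro ⟨w, hw, h, rfl⟩
    exact ⟨⟨w, h⟩, hw, rfl⟩
  · rintro ⟨w, hw, rfl⟩
    exact ⟨w, hw, w.2, rfl⟩

/-- The cone of the nonzero vectors whose classes belong to a set of the projective space. -/
def coneOver {K V : Type*} [Field K] [AddCommGroup V] [Module K V] (D : Set (ℙ K V)) : Set V :=
  {v | ∃ h : v ≠ 0, Projectivization.mk K v h ∈ D}

theorem isOpen_coneOver [TopologicalSpace V] [T1Space V] {D : Set (ℙ K V)} (hD : IsOpen D) :
    IsOpen (coneOver D) := by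
  have h1 : IsOpen {v : V | v ≠ 0} := isOpen_ne
  have h2 : IsOpen ((Projectivization.mk' K : {v : V // v ≠ 0} → ℙ K V) ⁻¹' D) :=
    hD.preimage continuous_quotient_mk'
  convert h1.isOpenMap_subtype_val _ h2
  ext v
  constructor
  · rintro ⟨h, hv⟩
    exact ⟨⟨v, h⟩, hv, rfl⟩
  · rintro ⟨w, hw, rfl⟩
    exact ⟨w.2, hw⟩

theorem smul_mem_coneOver {D : Set (ℙ K V)} {v : V} (hv : v ∈ coneOver D) {c : K} (hc : c ≠ 0) :
    c • v ∈ coneOver D := by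
  obtain ⟨h, hv⟩ := hv
  refine ⟨smul_ne_zero hc h, ?_⟩
  convert hv using 1
  exact (Projectivization.mk_eq_mk_iff' K _ _ _ _).2 ⟨c, rfl⟩

theorem mk_mem_setOf_submodule_le {W : Submodule K V} {w : V} (h : w ≠ 0) :
    Projectivization.mk K w h ∈ {x : ℙ K V | x.submodule ≤ W} ↔ w ∈ W := by
  rw [mem_ofPred_eq, Projectivization.submodule_mk, Submodule.span_singleton_le_iff_mem]

end ProjectiveTopology

/-! ### Contractibility of projected convex sets -/

section Contractible

variable {V : Type*} [NormedAddCommGroup V] [NormedSpace ℂ V]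

/-- A retract of a contractible space is contractible. -/
theorem ContractibleSpace.of_retract {X Y : Type*} [TopologicalSpace X] [TopologicalSpace Y]
    [ContractibleSpace Y] (s : C(X, Y)) (p : C(Y, X)) (h : p.comp s = ContinuousMap.id X) :
    ContractibleSpace X := by
  rw [contractible_iff_id_nullhomotopic, ← h]
  simpa using ((id_nullhomotopic Y).comp_right p).comp_left s

/-- The convex set `T ∩ W` is nowhere zero under the functional `f`; its image in the projective
space is a retract of it, because the fibres of the projection are convex. -/
theorem contractibleSpace_projImage (f : V →L[ℂ] ℂ) {T : Set V} (hTo : IsOpen T)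
    (hTc : Convex ℝ T) (hf : ∀ w ∈ T, f w ≠ 0) (W : Submodule ℂ V)
    (hne : (T ∩ (W : Set V)).Nonempty) :
    ContractibleSpace (projImage ℂ (T ∩ (W : Set V))) := by
  set U : Set V := T ∩ (W : Set V) with hU
  have hT0 : ∀ w ∈ T, w ≠ 0 := fun w hw h => hf w hw (by simp [h])
  have hUc : Convex ℝ U := hTc.inter (W.restrictScalars ℝ).convex
  have : ContractibleSpace U := hUc.contractibleSpace hne
  let S : Set V := {a | f a = 1 ∧ ∃ l : ℂ, l • a ∈ U}
  -- the normalization of representatives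
  let ν : ℙ ℂ V → V := Projectivization.lift (fun w : {w : V // w ≠ 0} => (f w)⁻¹ • (w : V)) (by
    rintro ⟨a, ha⟩ ⟨b, hb⟩ t (rfl : a = t • b)
    have ht : t ≠ 0 := by rintro rfl; simp at ha
    simp only [map_smul, smul_eq_mul, mul_inv, smul_smul]
    congr 1
    field_simp)
  have hν : ∀ w (h : w ≠ 0), ν (Projectivization.mk ℂ w h) = (f w)⁻¹ • w := fun w h => rfl
  have hνS : ∀ x ∈ projImage ℂ U, ν x ∈ S := by
    rintro x ⟨w, hw, h, rfl⟩
    rw [hν]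
    have := hf w hw.1
    exact ⟨by simp [this], f w, by simpa [smul_smul, this] using hw⟩
  have hνc : ContinuousOn ν (projImage ℂ U) := by
    rintro x ⟨w, hw, h, rfl⟩
    refine ContinuousAt.continuousWithinAt ?_
    have := (Projectivization.isOpenQuotientMap_mk' (K := ℂ) (V := V)).continuousAt_comp_iff
      (g := ν) (x := ⟨w, h⟩)
    refine this.1 ?_
    change ContinuousAt (fun w : {w : V // w ≠ 0} => (f w)⁻¹ • (w : V)) ⟨w, h⟩
    exact ContinuousAt.smul (ContinuousAt.inv₀ (by fun_prop) (hf w hw.1)) (by fun_prop)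
  -- A continuous choice of scalar. A fixed `l` keeps working near `a`: `T` is open, and every `b`
  -- in `S` lies in `W` already, being a nonzero multiple of a vector of `W`.
  obtain ⟨g, hg⟩ := exists_continuous_forall_mem_convex_of_local_const
    (X := S) (E := ℂ) (t := fun a => {l | l • (a : V) ∈ U}) (by
      intro a
      exact hUc.is_linear_preimage (f := fun l : ℂ => l • (a : V))
        ⟨fun x y => add_smul _ _ _, fun c x => smul_assoc _ _ _⟩) (by
      rintro ⟨a, ha, l, hl⟩
      refine ⟨l, ?_⟩
      have h1 : ∀ᶠ b : S in 𝓝 ⟨a, ha, l, hl⟩, l • (b : V) ∈ T :=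
        (Continuous.continuousAt (by fun_prop)).eventually (hTo.mem_nhds hl.1)
      filter_upwards [h1] with b hb
      refine ⟨hb, ?_⟩
      obtain ⟨-, m, hm⟩ := b.2
      have hm0 : m ≠ 0 := by rintro rfl; exact hT0 _ hm.1 (zero_smul _ _)
      exact W.smul_mem _ ((W.smul_mem_iff hm0).1 hm.2))
  let s : C(projImage ℂ U, U) :=
    ⟨fun x => ⟨g ⟨ν x, hνS x x.2⟩ • ν x, hg ⟨ν x, hνS x x.2⟩⟩, by
      have h1 : Continuous fun x : projImage ℂ U => ν x := continuousOn_iff_continuous_domRestrict.1 hνc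
      exact Continuous.subtype_mk ((g.continuous.comp (h1.subtype_mk _)).smul h1) _⟩
  let p : C(U, projImage ℂ U) :=
    ⟨fun w => ⟨Projectivization.mk' ℂ ⟨w, hT0 w w.2.1⟩, w, w.2, hT0 w w.2.1, rfl⟩, by
      refine Continuous.subtype_mk (continuous_quotient_mk'.comp ?_) _
      exact Continuous.subtype_mk continuous_subtype_val _⟩
  refine ContractibleSpace.of_retract s p ?_
  ext ⟨x, hx⟩
  obtain ⟨w, hw, h, rfl⟩ := hx
  refine (Projectivization.mk_eq_mk_iff' ℂ _ _ _ h).2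
    ⟨g ⟨_, hνS _ ⟨w, hw, h, rfl⟩⟩ * (f w)⁻¹, ?_⟩
  rw [mul_smul]
  rfl

end Contractible

/-! ### Choosing signs in a symmetric cone -/

section Cones

variable {V : Type*} [AddCommGroup V] [Module ℝ V]

/-- The nonnegative combinations of `a` and `b`, except the trivial one, belong to `P`. -/
def SectorSubset (P : Set V) (a b : V) : Prop :=
  ∀ c d : ℝ, 0 ≤ c → 0 ≤ d → 0 < c + d → c • a + d • b ∈ P

theorem SectorSubset.symm {P : Set V} {a b : V} (h : SectorSubset P a b) : SectorSubset P b a :=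
  fun c d hc hd hcd => by
    rw [add_comm]
    exact h d c hd hc (by linarith)

theorem SectorSubset.left_mem {P : Set V} {a b : V} (h : SectorSubset P a b) : a ∈ P := by
  simpa using h 1 0 (by norm_num) le_rfl (by norm_num)

theorem SectorSubset.right_mem {P : Set V} {a b : V} (h : SectorSubset P a b) : b ∈ P :=
  h.symm.left_mem

theorem SectorSubset.combination_right {P : Set V} {a b : V} (h : SectorSubset P a b) {c d : ℝ}
    (hc : 0 ≤ c) (hd : 0 ≤ d) (hcd : 0 < c + d) : SectorSubset P a (c • a + d • b) := by
  intro x y hx hy hxy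
  have : x • a + y • (c • a + d • b) = (x + y * c) • a + (y * d) • b := by module
  rw [this]
  refine h _ _ (by positivity) (by positivity) ?_
  rcases hy.eq_or_lt with rfl | hy
  · linarith
  · nlinarith [mul_pos hy hcd]

theorem SectorSubset.combination_mem {P : Set V} {a b : V} (h₁ : SectorSubset P a b)
    (h₂ : SectorSubset P a (-b)) (hP : ∀ v ∈ P, ∀ c : ℝ, c ≠ 0 → c • v ∈ P) {c d : ℝ}
    (hcd : c ≠ 0 ∨ d ≠ 0) : c • a + d • b ∈ P := by
  have neg : ∀ v, -v ∈ P → v ∈ P := fun v hv => by simpa using hP _ hv (-1) (by norm_num)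
  have pos : 0 < |c| + |d| := by
    rcases hcd with h | h
    · have := abs_pos.2 h; positivity
    · have := abs_pos.2 h; positivity
  rcases le_total 0 c with hc | hc <;> rcases le_total 0 d with hd | hd
  · rw [abs_of_nonneg hc, abs_of_nonneg hd] at pos
    exact h₁ c d hc hd pos
  · rw [abs_of_nonneg hc, abs_of_nonpos hd] at pos
    simpa using h₂ c (-d) hc (by linarith) pos
  · rw [abs_of_nonpos hc, abs_of_nonneg hd] at pos
    refine neg _ ?_
    convert h₂ (-c) d (by linarith) hd pos using 1
    module
  · rw [abs_of_nonpos hc, abs_of_nonpos hd] at pos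
    refine neg _ ?_
    convert h₁ (-c) (-d) (by linarith) (by linarith) pos using 1
    module

variable [TopologicalSpace V] [IsTopologicalAddGroup V] [ContinuousSMul ℝ V]

/-- By homogeneity a sector lies in `P` as soon as the segment from `a` to `b` does, and compactness
of that segment makes this an open condition. -/
theorem isOpen_setOf_sectorSubset {P : Set V} (hPo : IsOpen P)
    (hP : ∀ v ∈ P, ∀ c : ℝ, c ≠ 0 → c • v ∈ P) (b : V) :
    IsOpen {a | SectorSubset P a b} := by
  rw [isOpen_iff_mem_nhds]
  intro a ha
  have key : ∀ᶠ a' in 𝓝 a, ∀ s ∈ Icc (0 : ℝ) 1, (1 - s) • a' + s • b ∈ P := by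
    refine isCompact_Icc.eventually_forall_of_forall_eventually fun s hs => ?_
    have hc : Continuous fun z : V × ℝ => (1 - z.2) • z.1 + z.2 • b := by fun_prop
    exact hc.continuousAt.eventually
      (hPo.mem_nhds (ha (1 - s) s (by linarith [hs.2]) hs.1 (by linarith)))
  filter_upwards [key] with a' h c d hc hd hcd
  have h1 := hP _ (h (d / (c + d)) ⟨by positivity, by rw [div_le_one hcd]; linarith⟩) _ hcd.ne'
  convert h1 using 1
  rw [smul_add, smul_smul, smul_smul]
  congr 2 <;> field_simp
  ring

/-- An open symmetric cone, any two vectors of which span a sector in it after exactly one choice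
of signs, is the union of an open convex cone and its negative. -/
theorem exists_convex_cone_of_symmetric_cone {P : Set V} (hPo : IsOpen P) (hP0 : (0 : V) ∉ P)
    (hP : ∀ v ∈ P, ∀ c : ℝ, c ≠ 0 → c • v ∈ P)
    (hor : ∀ a ∈ P, ∀ b ∈ P, SectorSubset P a b ∨ SectorSubset P a (-b))
    (hand : ∀ a b, SectorSubset P a b → ¬ SectorSubset P a (-b)) (hne : P.Nonempty) :
    ∃ C : Set V, IsOpen C ∧ Convex ℝ C ∧ (0 : V) ∉ C ∧ (∀ v ∈ C, ∀ c : ℝ, 0 < c → c • v ∈ C) ∧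
      ∀ v, v ∈ P ↔ v ∈ C ∨ -v ∈ C := by
  -- The cone will consist of the vectors on the same side as `e`. Transitivity holds because, along
  -- the segment from `e` to `a`, the sign to be given to `b` is locally constant.
  obtain ⟨e, he⟩ := hne
  have trans : ∀ e a b, SectorSubset P e a → SectorSubset P e b → SectorSubset P a b := by
    intro e a b ha hb
    let w : ℝ → V := fun t => (1 - t) • e + t • a
    have hw : Continuous w := by fun_prop
    have hwP : ∀ t ∈ Icc (0 : ℝ) 1, w t ∈ P := fun t ht =>
      ha _ _ (by linarith [ht.2]) ht.1 (by linarith)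
    have hpre : IsPreconnected (Icc (0 : ℝ) 1) := isPreconnected_Icc
    by_contra hab
    obtain ⟨t, ht, h1, h2⟩ := hpre _ _
      ((isOpen_setOf_sectorSubset hPo hP b).preimage hw)
      ((isOpen_setOf_sectorSubset hPo hP (-b)).preimage hw)
      (fun t ht => hor _ (hwP t ht) _ hb.right_mem)
      ⟨0, by simp, by simpa [w] using hb⟩
      ⟨1, by simp, by simpa [w] using (hor _ ha.right_mem _ hb.right_mem).resolve_left hab⟩
    exact hand _ _ h1 h2
  refine ⟨{w | SectorSubset P e w}, ?_, ?_, fun h => hP0 h.right_mem, ?_, fun v => ⟨hor e he v, ?_⟩⟩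
  · convert isOpen_setOf_sectorSubset hPo hP e using 3
    exact ⟨SectorSubset.symm, SectorSubset.symm⟩
  · intro a ha b hb c d hc hd hcd
    exact trans a _ _ (SectorSubset.symm ha)
      ((trans e a b ha hb).combination_right hc hd (by linarith))
  · intro v hv c hc
    simpa using SectorSubset.combination_right hv le_rfl hc.le (by linarith)
  · rintro (h | h)
    · exact h.right_mem
    · simpa using hP _ h.right_mem (-1) (by norm_num)

end Cones

/-! ### Lifting a projectively convex set to a convex cone -/

section Lift

theorem isProjectiveLine_span_pair {K V : Type*} [Field K] [AddCommGroup V] [Module K V] {a b : V}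
    (h : LinearIndependent K ![a, b]) :
    IsProjectiveLine {x : ℙ K V | x.submodule ≤ Submodule.span K {a, b}} := by
  refine ⟨_, ?_, rfl⟩
  have := finrank_span_eq_card h
  rw [Matrix.range_cons_cons_empty, Fintype.card_fin] at this
  exact this

/-- Coordinates on the plane, extended to all of `V` so that sign conditions on them define open
sets of the ambient projective space. -/
theorem exists_dual_pair {K V : Type*} [Field K] [AddCommGroup V] [Module K V] {a b : V}
    (h : LinearIndependent K ![a, b]) :
    ∃ φ ψ : V →ₗ[K] K, φ a = 1 ∧ φ b = 0 ∧ ψ a = 0 ∧ ψ b = 1 := by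
  let F : K × K →ₗ[K] V :=
    (LinearMap.toSpanSingleton K V a).coprod (LinearMap.toSpanSingleton K V b)
  obtain ⟨g, hg⟩ := F.exists_leftInverse_of_injective (by
    rw [LinearMap.ker_eq_bot']
    rintro ⟨x, y⟩ hxy
    have := LinearIndependent.pair_iff.1 h x y (by simpa [F] using hxy)
    ext <;> simp [this])
  have ha : g a = (1, 0) := by simpa [F] using LinearMap.congr_fun hg (1, 0)
  have hb : g b = (0, 1) := by simpa [F] using LinearMap.congr_fun hg (0, 1)
  exact ⟨LinearMap.fst K K K ∘ₗ g, LinearMap.snd K K K ∘ₗ g, by simp [ha], by simp [hb],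
    by simp [ha], by simp [hb]⟩

variable {n : ℕ} {D : Set (RealProj n)}

theorem IsProjConvex.not_sectorSubset_neg (hD : IsProjConvex D) (a b : Fin (n + 1) → ℝ)
    (h₁ : SectorSubset (coneOver D) a b) : ¬ SectorSubset (coneOver D) a (-b) := by
  intro h₂
  have key : ∀ c d : ℝ, c ≠ 0 ∨ d ≠ 0 → c • a + d • b ∈ coneOver D := fun c d h =>
    h₁.combination_mem h₂ (fun v hv c hc => smul_mem_coneOver hv hc) h
  have hli : LinearIndependent ℝ ![a, b] := by
    rw [LinearIndependent.pair_iff]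
    intro c d h
    by_contra! hcd
    obtain ⟨h0, -⟩ := key c d (by tauto)
    exact h0 h
  refine (hD _ (isProjectiveLine_span_pair hli)).1 fun x hx => ?_
  induction x using Projectivization.ind with | h w hw =>
  rw [mk_mem_setOf_submodule_le, Submodule.mem_span_pair] at hx
  obtain ⟨c, d, rfl⟩ := hx
  obtain ⟨_, h⟩ := key c d (by
    by_contra! h
    simp [h] at hw)
  exact h

/-- If both sectors left the cone, the line through `[a]` and `[b]` would have a missing point on
each of its two arcs between them, so its trace on `D` would be disconnected. -/
theorem IsProjConvex.sectorSubset_or_neg (hD : IsProjConvex D) (a : Fin (n + 1) → ℝ)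
    (ha : a ∈ coneOver D) (b : Fin (n + 1) → ℝ) (hb : b ∈ coneOver D) :
    SectorSubset (coneOver D) a b ∨ SectorSubset (coneOver D) a (-b) := by
  have hP : ∀ v ∈ coneOver D, ∀ c : ℝ, c ≠ 0 → c • v ∈ coneOver D :=
    fun v hv c hc => smul_mem_coneOver hv hc
  by_cases hli : LinearIndependent ℝ ![a, b]
  swap
  · rw [LinearIndependent.pair_iff' ha.1] at hli
    push Not at hli
    obtain ⟨k, rfl⟩ := hli
    have hk : k ≠ 0 := by rintro rfl; exact hb.1 (zero_smul _ _)
    rcases hk.lt_or_gt with hk | hk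
    · refine Or.inr fun c d hc hd hcd => ?_
      have : c • a + d • -(k • a) = (c + d * -k) • a := by module
      rw [this]
      refine hP _ ha _ ?_
      rcases hd.eq_or_lt with rfl | hd
      · linarith
      · nlinarith [mul_pos hd (neg_pos.2 hk)]
    · refine Or.inl fun c d hc hd hcd => ?_
      have : c • a + d • k • a = (c + d * k) • a := by module
      rw [this]
      refine hP _ ha _ ?_
      rcases hd.eq_or_lt with rfl | hd
      · linarith
      · nlinarith [mul_pos hd hk]
  obtain ⟨φ, ψ, hφa, hφb, hψa, hψb⟩ := exists_dual_pair hli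
  have hpos : ∀ x, x ∈ coneOver D → ∀ c d : ℝ, 0 ≤ c → 0 ≤ d → 0 < c + d →
      c • a + d • x ∉ coneOver D → 0 < c ∧ 0 < d := by
    intro x hx c d hc hd hcd h
    constructor
    · refine hc.lt_of_ne' ?_
      rintro rfl
      exact h (by simpa using hP x hx d (by linarith))
    · refine hd.lt_of_ne' ?_
      rintro rfl
      exact h (by simpa using hP a ha c (by linarith))
  by_contra! hcon
  obtain ⟨h₁, h₂⟩ := hcon
  unfold SectorSubset at h₁ h₂
  push Not at h₁ h₂
  obtain ⟨c, d, hc, hd, hcd, hu⟩ := h₁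
  obtain ⟨c', d', hc', hd', hcd', hu'⟩ := h₂
  have hnb : -b ∈ coneOver D := by simpa using hP b hb (-1) (by norm_num)
  obtain ⟨hc, hd⟩ := hpos b hb c d hc hd hcd hu
  obtain ⟨hc', hd'⟩ := hpos (-b) hnb c' d' hc' hd' hcd' hu'
  -- a quadratic form that separates `a` from `b` and vanishes only outside of the cone
  let Q : (Fin (n + 1) → ℝ) → ℝ := fun w => (c * ψ w - d * φ w) * (c' * ψ w + d' * φ w)
  have hφ : Continuous φ := φ.continuous_of_finiteDimensional
  have hψ : Continuous ψ := ψ.continuous_of_finiteDimensional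
  have hQ : Continuous Q := by fun_prop
  have hQs : ∀ (t : ℝ) w, Q (t • w) = t ^ 2 * Q w := fun t w => by
    simp only [Q, map_smul, smul_eq_mul]; ring
  have hQa : Q a < 0 := by
    simp only [Q, hφa, hψa]; nlinarith [mul_pos hd hd']
  have hQb : 0 < Q b := by
    simp only [Q, hφb, hψb]; nlinarith [mul_pos hc hc']
  have hQ0 : ∀ x y : ℝ, x • a + y • b ∈ coneOver D → Q (x • a + y • b) ≠ 0 := by
    intro x y hxy h0
    have e1 : φ (x • a + y • b) = x := by simp [hφa, hφb]
    have e2 : ψ (x • a + y • b) = y := by simp [hψa, hψb]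
    simp only [Q, e1, e2] at h0
    have hx : x ≠ 0 := by
      rintro rfl
      have : y = 0 := by
        rcases mul_eq_zero.1 h0 with h | h
        · simpa [hc.ne'] using h
        · simpa [hc'.ne'] using h
      exact hxy.1 (by simp [this])
    rcases mul_eq_zero.1 h0 with h | h
    · refine hu ?_
      convert hP _ hxy (c / x) (div_ne_zero hc.ne' hx) using 1
      rw [smul_add, smul_smul, smul_smul]
      congr 2
      · field_simp
      · field_simp; linarith
    · refine hu' ?_
      convert hP _ hxy (c' / x) (div_ne_zero hc'.ne' hx) using 1
      rw [smul_add, smul_smul, smul_smul, smul_neg, ← neg_smul]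
      congr 2
      · field_simp
      · field_simp; linarith
  obtain ⟨-, hpre⟩ := hD _ (isProjectiveLine_span_pair hli)
  have hmem : ∀ w ∈ Submodule.span ℝ {a, b}, ∀ h : w ∈ coneOver D,
      Projectivization.mk ℝ w h.1 ∈ D ∩ {x | x.submodule ≤ Submodule.span ℝ {a, b}} :=
    fun w hw h => ⟨h.2, (mk_mem_setOf_submodule_le _).2 hw⟩
  -- The sign of `Q` is invariant under scaling, so it splits the trace of `D` on the line into two
  -- disjoint open pieces.
  obtain ⟨x, -, ⟨w, hw, hw0, rfl⟩, ⟨v, hv, hv0, hx⟩⟩ := hpre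
    (projImage ℝ {w | Q w < 0}) (projImage ℝ {w | 0 < Q w})
    (isOpen_projImage (isOpen_lt hQ continuous_const))
    (isOpen_projImage (isOpen_lt continuous_const hQ)) (by
      rintro x ⟨hxD, hxL⟩
      induction x using Projectivization.ind with | h w hw =>
      rw [mk_mem_setOf_submodule_le, Submodule.mem_span_pair] at hxL
      obtain ⟨x, y, rfl⟩ := hxL
      rcases (hQ0 x y ⟨hw, hxD⟩).lt_or_gt with h | h
      · exact Or.inl ⟨_, h, hw, rfl⟩
      · exact Or.inr ⟨_, h, hw, rfl⟩)
    ⟨_, hmem a (Submodule.subset_span (by simp)) ha, a, hQa, ha.1, rfl⟩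
    ⟨_, hmem b (Submodule.subset_span (by simp)) hb, b, hQb, hb.1, rfl⟩
  obtain ⟨t, rfl⟩ := (Projectivization.mk_eq_mk_iff' ℝ _ _ hw0 hv0).1 hx
  rw [mem_ofPred_eq, hQs] at hw
  rw [mem_ofPred_eq] at hv
  nlinarith [sq_nonneg t]

/-- An open convex set of the projective space is the image of an open convex cone. -/
theorem IsProjConvex.exists_convex_cone (hD : IsProjConvex D) (hDo : IsOpen D)
    (hne : D.Nonempty) :
    ∃ C : Set (Fin (n + 1) → ℝ), IsOpen C ∧ Convex ℝ C ∧ (0 : Fin (n + 1) → ℝ) ∉ C ∧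
      (∀ v ∈ C, ∀ c : ℝ, 0 < c → c • v ∈ C) ∧ ∀ v, v ∈ coneOver D ↔ v ∈ C ∨ -v ∈ C := by
  refine exists_convex_cone_of_symmetric_cone (isOpen_coneOver hDo) (fun h => h.1 rfl)
    (fun v hv c hc => smul_mem_coneOver hv hc) hD.sectorSubset_or_neg hD.not_sectorSubset_neg ?_
  obtain ⟨x, hx⟩ := hne
  exact ⟨x.rep, x.rep_nonzero, by rwa [x.mk_rep]⟩

end Lift

/-! ### The elliptic tube as the projectivization of `C + iC` -/

section Tube

variable {n : ℕ}

/-- The vectors of `ℂ^(n+1)` whose real and imaginary parts belong to `C`. -/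
def complexTube (C : Set (Fin (n + 1) → ℝ)) : Set (Fin (n + 1) → ℂ) :=
  {w | (fun i => (w i).re) ∈ C ∧ (fun i => (w i).im) ∈ C}

theorem isOpen_complexTube {C : Set (Fin (n + 1) → ℝ)} (hC : IsOpen C) :
    IsOpen (complexTube C) := by
  have h1 : Continuous fun w : Fin (n + 1) → ℂ => fun i => (w i).re := by fun_prop
  have h2 : Continuous fun w : Fin (n + 1) → ℂ => fun i => (w i).im := by fun_prop
  exact (hC.preimage h1).inter (hC.preimage h2)

theorem convex_complexTube {C : Set (Fin (n + 1) → ℝ)} (hC : Convex ℝ C) :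
    Convex ℝ (complexTube C) := by
  intro w hw z hz s t hs ht hst
  constructor
  · convert hC hw.1 hz.1 hs ht hst using 1
    ext i; simp
  · convert hC hw.2 hz.2 hs ht hst using 1
    ext i; simp

/-- An open convex cone without the origin has a complex functional without zeros in its tube. -/
theorem exists_functional_ne_zero {C : Set (Fin (n + 1) → ℝ)} (hCo : IsOpen C)
    (hCc : Convex ℝ C) (hC0 : (0 : Fin (n + 1) → ℝ) ∉ C) :
    ∃ f : (Fin (n + 1) → ℂ) →L[ℂ] ℂ, ∀ w ∈ complexTube C, f w ≠ 0 := by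
  obtain ⟨f, hf⟩ := geometric_hahn_banach_open_point hCc hCo hC0
  -- The complex-linear extension of `f`; its real part at `w` is `f (Re w) < 0`.
  refine ⟨∑ i, (f (Pi.single i 1) : ℂ) • ContinuousLinearMap.proj i, fun w hw h => ?_⟩
  have h1 := hf _ hw.1
  rw [map_zero, ← Finset.univ_sum_single (fun i => (w i).re), map_sum]
    at h1
  have h2 := congrArg Complex.re h
  simp only [sum_apply, smul_apply,
    ContinuousLinearMap.proj_apply, smul_eq_mul, Complex.re_sum, Complex.re_ofReal_mul,
    Complex.zero_re] at h2
  refine h1.ne (h2 ▸ Finset.sum_congr rfl fun i _ => ?_)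
  have : (Pi.single i (w i).re : Fin (n + 1) → ℝ) = (w i).re • Pi.single i 1 := by
    rw [← Pi.single_smul, smul_eq_mul, mul_one]
  change f (Pi.single i (w i).re) = _
  rw [this, map_smul, smul_eq_mul, mul_comm]

theorem mem_projImage_of_smul {U : Set (Fin (n + 1) → ℂ)} (hU : (0 : Fin (n + 1) → ℂ) ∉ U)
    {w : Fin (n + 1) → ℂ} (h : w ≠ 0) (l : ℂ) (hl : l • w ∈ U) :
    Projectivization.mk ℂ w h ∈ projImage ℂ U := by
  have h0 : l • w ≠ 0 := fun h0 => hU (h0 ▸ hl)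
  exact ⟨l • w, hl, h0, ((Projectivization.mk_eq_mk_iff' ℂ _ _ _ _).2 ⟨l, rfl⟩).symm⟩

theorem add_mem_of_convex_cone {V : Type*} [AddCommGroup V] [Module ℝ V] {C : Set V}
    (hCc : Convex ℝ C) (hC : ∀ v ∈ C, ∀ c : ℝ, 0 < c → c • v ∈ C) {a b : V} (ha : a ∈ C)
    (hb : b ∈ C) {c d : ℝ} (hc : 0 ≤ c) (hd : 0 ≤ d) (hcd : 0 < c + d) : c • a + d • b ∈ C := by
  rcases hc.eq_or_lt with rfl | hc
  · simpa using hC b hb d (by linarith)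
  rcases hd.eq_or_lt with rfl | hd
  · simpa using hC a ha c hc
  have := hC _ (hCc ha hb (div_pos hc hcd).le (div_pos hd hcd).le (by field_simp)) _ hcd
  convert this using 1
  rw [smul_add, smul_smul, smul_smul]
  congr 2 <;> field_simp

/-- The disc over a segment between two vectors of a convex cone lies in the image of the tube. -/
theorem mk_combination_mem_projImage {C : Set (Fin (n + 1) → ℝ)} (hCc : Convex ℝ C)
    (hC0 : (0 : Fin (n + 1) → ℝ) ∉ C) (hC : ∀ v ∈ C, ∀ c : ℝ, 0 < c → c • v ∈ C)
    {a b : Fin (n + 1) → ℝ} (ha : a ∈ C) (hb : b ∈ C) {c d : ℂ} (hcd : 0 ≤ (c * conj d).re)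
    (h : c • complexifyVec a + d • complexifyVec b ≠ 0) :
    Projectivization.mk ℂ _ h ∈ projImage ℂ (complexTube C) := by
  have h0 : (0 : Fin (n + 1) → ℂ) ∉ complexTube C := fun h0 => hC0 h0.1
  -- it suffices to rotate both coefficients into the first quadrant
  have key : ∀ l : ℂ, 0 ≤ (l * c).re → 0 ≤ (l * d).re → 0 < (l * c).re + (l * d).re →
      0 ≤ (l * c).im → 0 ≤ (l * d).im → 0 < (l * c).im + (l * d).im →
      Projectivization.mk ℂ _ h ∈ projImage ℂ (complexTube C) := by
    intro l h1 h2 h3 h4 h5 h6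
    refine mem_projImage_of_smul h0 h l ?_
    rw [smul_add, smul_smul, smul_smul]
    constructor
    · convert add_mem_of_convex_cone hCc hC ha hb h1 h2 h3 using 1
      ext i
      simp [complexifyVec]
    · convert add_mem_of_convex_cone hCc hC ha hb h4 h5 h6 using 1
      ext i
      simp [complexifyVec]
  by_cases hc : c = 0
  · subst hc
    have hd : d ≠ 0 := by rintro rfl; simp at h
    have e : (1 + Complex.I) / d * d = 1 + Complex.I := div_mul_cancel₀ _ hd
    apply key ((1 + Complex.I) / d) <;> simp [e]
  have hcc : 0 < c.re * c.re + c.im * c.im := by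
    simpa [Complex.normSq_apply] using Complex.normSq_pos.2 hc
  have hre : 0 ≤ c.re * d.re + c.im * d.im := by simpa using hcd
  -- Multiplying by `conj c` makes `c` positive and puts `d` in the right half-plane; the sign of
  -- the imaginary part of `d * conj c` decides the further rotation.
  rcases lt_trichotomy (c.re * d.im - c.im * d.re) 0 with hq | hq | hq
  · apply key (Complex.I * conj c) <;> simp <;> nlinarith
  · apply key ((1 + Complex.I) * conj c) <;> simp <;> nlinarith
  · apply key (conj c) <;> simp <;> nlinarith

theorem ellipticTube_eq_projImage {D : Set (RealProj n)} (hD : IsProjConvex D)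
    {C : Set (Fin (n + 1) → ℝ)} (hCc : Convex ℝ C) (hC0 : (0 : Fin (n + 1) → ℝ) ∉ C)
    (hC : ∀ v ∈ C, ∀ c : ℝ, 0 < c → c • v ∈ C)
    (hCD : ∀ v, v ∈ coneOver D ↔ v ∈ C ∨ -v ∈ C) :
    ellipticTube D = projImage ℂ (complexTube C) := by
  ext z
  constructor
  · have key : ∀ a b : Fin (n + 1) → ℝ, a ∈ C → b ≠ 0 → closedSeg a b ⊆ D →
        ∀ c d : ℂ, 0 ≤ (c * conj d).re → ∀ h : c • complexifyVec a + d • complexifyVec b ≠ 0,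
          Projectivization.mk ℂ _ h ∈ projImage ℂ (complexTube C) := by
      intro a b ha hb hab c d hcd h
      have hbD : b ∈ coneOver D :=
        ⟨hb, hab ⟨0, 1, by simp, by simpa using hb, by simp⟩⟩
      rcases (hCD b).1 hbD with hbC | hbC
      · exact mk_combination_mem_projImage hCc hC0 hC ha hbC hcd h
      -- the segment is degenerate
      have h1 : SectorSubset (coneOver D) a (-b) := fun p q hp hq hpq =>
        (hCD _).2 (Or.inl (add_mem_of_convex_cone hCc hC ha hbC hp hq hpq))
      have h2 : ¬ SectorSubset (coneOver D) a b := fun h2 => hD.not_sectorSubset_neg a b h2 h1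
      unfold SectorSubset at h2
      push Not at h2
      -- As `closedSeg a b ⊆ D` covers all nonzero combinations, the sector can fail only at a
      -- vanishing one.
      obtain ⟨p, q, hp, hq, hpq, hnot⟩ := h2
      have h0 : p • a + q • b = 0 := by
        by_contra h0
        exact hnot ⟨h0, hab ⟨p, q, mul_nonneg hp hq, h0, rfl⟩⟩
      have hq0 : q ≠ 0 := by
        rintro rfl
        rcases smul_eq_zero.1 (by simpa using h0 : p • a = 0) with rfl | rfl
        · simp at hpq
        · exact hC0 ha
      obtain ⟨k, rfl⟩ : ∃ k : ℝ, b = k • a := by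
        refine ⟨-(p / q), smul_right_injective _ hq0 ?_⟩
        change q • b = q • (-(p / q)) • a
        rw [smul_smul, eq_neg_of_add_eq_zero_right h0, ← neg_smul]
        congr 1
        field_simp
      have e : c • complexifyVec a + d • complexifyVec (k • a) =
          (c + d * k) • complexifyVec a + (0 : ℂ) • complexifyVec a := by
        ext i
        simp [complexifyVec]
        ring
      have := mk_combination_mem_projImage hCc hC0 hC ha ha (c := c + d * k) (d := 0) (by simp)
        (e ▸ h)
      simpa only [e] using this
    rintro ⟨a, b, ha, hb, hab, c, d, hcd, h, rfl⟩
    have haD : a ∈ coneOver D := ⟨ha, hab ⟨1, 0, by simp, by simpa using ha, by simp⟩⟩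
    rcases (hCD a).1 haD with haC | haC
    · exact key a b haC hb hab c d hcd h
    have e : (-c) • complexifyVec (-a) + (-d) • complexifyVec (-b) =
        c • complexifyVec a + d • complexifyVec b := by
      ext i
      simp [complexifyVec]
    have := key (-a) (-b) haC (neg_ne_zero.2 hb) (by
      rintro x ⟨p, q, hpq, h', rfl⟩
      have e' : p • -a + q • -b = (-p) • a + (-q) • b := by module
      exact hab ⟨-p, -q, by simpa using hpq, e' ▸ h', by simp only [e']⟩)
      (-c) (-d) (by simpa using hcd) (e ▸ h)
    simpa only [e] using this
  · rintro ⟨w, hw, h, rfl⟩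
    -- The segment joins `[Re w]` to `[Im w]`; the coefficients `1` and `i` put `w = Re w + i Im w`
    -- in the boundary case `Re (c₀ * conj c₁) = 0`.
    refine ⟨_, _, fun h0 => hC0 (h0 ▸ hw.1), fun h0 => hC0 (h0 ▸ hw.2), ?_, 1, Complex.I,
      by simp, ?_⟩
    · rintro x ⟨c, d, hcd, h, rfl⟩
      suffices c • (fun i => (w i).re) + d • (fun i => (w i).im) ∈ coneOver D from this.2
      rw [hCD]
      have hne : c ≠ 0 ∨ d ≠ 0 := by
        by_contra! hne
        simp [hne] at h
      rcases mul_nonneg_iff.1 hcd with ⟨hc, hd⟩ | ⟨hc, hd⟩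
      · refine Or.inl (add_mem_of_convex_cone hCc hC hw.1 hw.2 hc hd ?_)
        rcases hne with h | h
        · have := hc.lt_of_ne' h; linarith
        · have := hd.lt_of_ne' h; linarith
      · refine Or.inr ?_
        convert add_mem_of_convex_cone hCc hC hw.1 hw.2 (neg_nonneg.2 hc) (neg_nonneg.2 hd) ?_
          using 1
        · module
        rcases hne with h | h
        · have := hc.lt_of_ne h; linarith
        · have := hd.lt_of_ne h; linarith
    · have e : (1 : ℂ) • complexifyVec (fun i => (w i).re) +
          Complex.I • complexifyVec (fun i => (w i).im) = w := by
        ext i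
        simp [complexifyVec, mul_comm Complex.I, Complex.re_add_im]
      exact ⟨by rwa [e], by simp only [e]⟩

end Tube

theorem mainTheorem12 (n : ℕ) (D : Set (RealProj n)) (hDopen : IsOpen D)
    (hDconvex : IsProjConvex D) : IsComplexConvex (ellipticTube D) := by
  intro L hL
  obtain ⟨W, hW, rfl⟩ := hL
  have hWpos : ∃ w ∈ W, w ≠ 0 := by
    refine W.ne_bot_iff.1 ?_
    rintro rfl
    simp at hW
  rcases D.eq_empty_or_nonempty with rfl | hne
  · have : ellipticTube (∅ : Set (RealProj n)) = ∅ := by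
      refine eq_empty_iff_forall_notMem.2 ?_
      rintro z ⟨a, b, ha, hb, hab, -⟩
      exact hab ⟨1, 0, by simp, by simpa using ha, rfl⟩
    obtain ⟨w, hw, hw0⟩ := hWpos
    rw [this, empty_inter]
    exact ⟨fun h => h ((mk_mem_setOf_submodule_le hw0).2 hw), isPreconnected_empty,
      fun h => absurd h not_nonempty_empty⟩
  obtain ⟨C, hCo, hCc, hC0, hC, hCD⟩ := hDconvex.exists_convex_cone hDopen hne
  rw [ellipticTube_eq_projImage hDconvex hCc hC0 hC hCD]
  obtain ⟨f, hf⟩ := exists_functional_ne_zero hCo hCc hC0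
  have heq : projImage ℂ (complexTube C) ∩ {x | x.submodule ≤ W} =
      projImage ℂ (complexTube C ∩ (W : Set (Fin (n + 1) → ℂ))) := by
    ext x
    constructor
    · rintro ⟨⟨w, hw, h, rfl⟩, hx⟩
      exact ⟨w, ⟨hw, (mk_mem_setOf_submodule_le h).1 hx⟩, h, rfl⟩
    · rintro ⟨w, ⟨hw, hwW⟩, h, rfl⟩
      exact ⟨⟨w, hw, h, rfl⟩, (mk_mem_setOf_submodule_le h).2 hwW⟩
  have hsc : (projImage ℂ (complexTube C ∩ (W : Set (Fin (n + 1) → ℂ)))).Nonempty →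
      IsSimplyConnected (projImage ℂ (complexTube C ∩ (W : Set (Fin (n + 1) → ℂ)))) := by
    rintro ⟨x, w, hw, -⟩
    have := contractibleSpace_projImage f (isOpen_complexTube hCo) (convex_complexTube hCc) hf W
      ⟨w, hw⟩
    exact SimplyConnectedSpace.ofContractible _
  refine ⟨fun hsub => ?_, ?_, ?_⟩
  -- A plane meets the kernel of `f` nontrivially.
  · obtain ⟨v, hv, hv0⟩ : ∃ v ∈ LinearMap.ker (f.toLinearMap ∘ₗ W.subtype), v ≠ 0 := by
      refine (Submodule.ne_bot_iff _).1 (LinearMap.ker_ne_bot_of_finrank_lt ?_)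
      simp [hW]
    have hv0' : (v : Fin (n + 1) → ℂ) ≠ 0 := by simpa using hv0
    obtain ⟨w, hw, h, hx⟩ := hsub ((mk_mem_setOf_submodule_le hv0').2 v.2)
    obtain ⟨t, ht⟩ := (Projectivization.mk_eq_mk_iff' ℂ _ _ hv0' h).1 hx
    have hfv : f v = 0 := by simpa using hv
    rw [← ht, map_smul, smul_eq_mul, mul_eq_zero] at hfv
    rcases hfv with rfl | hfv
    · exact hv0' (by simpa using ht.symm)
    · exact hf w hw hfv
  · rw [heq]
    rcases eq_empty_or_nonempty (projImage ℂ (complexTube C ∩ (W : Set (Fin (n + 1) → ℂ))))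
      with h | h
    · rw [h]; exact isPreconnected_empty
    · exact (hsc h).isPathConnected.isConnected.isPreconnected
  · rw [heq]
    exact hsc
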